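/- Let $k\ge 2$. A sequence $(t_n)_{n\ge 0}$ is $k$-admissible if $t_0=0$, $t_1=1$ and $(t_n)_{n\ge 2}$ is a sequence in $(0,1)$, dense in $(0,1)$, in which each value occurs at most $k$ times. For $n\ge 2$ let $\mathcal T_n=(\tau_{n,1}\le\dots\le\tau_{n,n+2k-1})$ be the increasing arrangement, with multiplicities, of $t_2,\dots,t_n$ and of the points $0$ and $1$, each taken $k$ times. For $1\le\ell\le k$ put $D^{(\ell)}_{n,i}=[\tau_{n,i},\tau_{n,i+\ell}]$. The sequence is $(k-1)$-regular with parameter $\gamma\ge 1$ if $\gamma^{-1}|D^{(k-1)}_{n,i}|\le|D^{(k-1)}_{n,i+1}|\le\gamma|D^{(k-1)}_{n,i}|$ for all $n\ge2$ and $2\le i\le n+k-2$. For $n\ge 2$ a characteristic interval $J_n$ is chosen as follows. Let $k+1\le i_0\le n+k-1$ with $\tau_{n,i_0}=t_n$ and write $\tau_j=\tau_{n,j}$. Let $\Lambda^{(0)}$ be the set of $j\in\{i_0-k,\dots,i_0\}$ with $\tau_{j+k}-\tau_j\le 2\min_{i_0-k\le l\le i_0}(\tau_{l+k}-\tau_l)$.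 Let $j^{(0)}$ be any index in $\Lambda^{(0)}$ that maximizes $|\alpha_j|$ over $j\in\Lambda^{(0)}$, where $$\alpha_j=(-1)^{j-i_0+k}\Big(\prod_{l=i_0-k+1}^{j-1}\frac{\tau_{i_0}-\tau_l}{\tau_{l+k}-\tau_l}\Big)\Big(\prod_{l=j+1}^{i_0-1}\frac{\tau_{l+k}-\tau_{i_0}}{\tau_{l+k}-\tau_l}\Big).$$ Then $J_n$ is any one of the intervals $[\tau_{j^{(0)}+r},\tau_{j^{(0)}+r+1}]$, $0\le r<k$, of maximal length. For an interval $V\subset[0,1]$ let $d_n(V)$ be the number of points of $\mathcal T_n$, with multiplicities, between $V$ and $J_n$, counting end points of both. Let $\operatorname{card}(V\cap\mathcal T_n)$ be the number of points of $\mathcal T_n$ in $V$, counted with multiplicities, where the boundary points $0$ and $1$ are each counted $k-1$ times (that is, the number of $2\le j\le n+2k-2$ with $\tau_{n,j}\in V$). For $\Delta=D^{(k-1)}_{m,i}$ with $m\ge2$, $2\le i\le m+k-1$, and an integer $\ell\ge0$ put $$N(\Delta)=\{n\ge2:\operatorname{card}(\Delta\cap\mathcal T_n)=k,\ J_n\subset\Delta\},$$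 $$M(\Delta,\ell)=\{n\ge2: d_n(\Delta)=\ell,\ \operatorname{card}(\Delta\cap\mathcal T_n)\ge k,\ |J_n\cap\Delta|=0\}.$$ **Lemma 3.7.** For every $k\ge2$ there is a constant $C_k$, and for every $k\ge 2$ and $\gamma\ge1$ there is a constant $C_{k,\gamma}$, such that the following holds. Let $(t_n)$ be $k$-admissible and $(k-1)$-regular with parameter $\gamma$, and let the characteristic intervals be chosen in any of the admissible ways. Then, for all $\Delta=D^{(k-1)}_{m,i}$ as above and all $\ell\ge0$, $$\frac1{|\Delta|}\sum_{n\in N(\Delta)}|J_n|\le C_k\qquad\text{and}\qquad \sum_{n\in M(\Delta,\ell)}\frac{|J_n|}{\operatorname{dist}(J_n,\Delta)+|\Delta|}\le C_{k,\gamma}(\ell+1)^2 .$$ -/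

import Mathlib

open MeasureTheory

namespace SplineKnots

noncomputable section

/-- `k`-admissible point sequences: `t 0 = 0`, `t 1 = 1`, and `(t n)`, `n ≥ 2`, is a sequence in
the open interval `(0, 1)`, dense there, in which every value occurs at most `k` times. -/
structure IsAdmissible (k : ℕ) (t : ℕ → ℝ) : Prop where
  zero : t 0 = 0
  one : t 1 = 1
  mem_Ioo : ∀ n, 2 ≤ n → t n ∈ Set.Ioo (0 : ℝ) 1
  dense : Set.Ioo (0 : ℝ) 1 ⊆ closure (t '' Set.Ici 2)
  mult_le : ∀ x : ℝ, {n : ℕ | 2 ≤ n ∧ t n = x}.encard ≤ k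

/-- The points of the grid `𝒯ₙ` with multiplicities: `0` and `1` with multiplicity `k` each,
and `t 2, …, t n`. -/
def gridPoints (k : ℕ) (t : ℕ → ℝ) (n : ℕ) : Multiset ℝ :=
  Multiset.replicate k 0 + Multiset.replicate k 1 + (Finset.Icc 2 n).val.map t

/-- The knots `τₙ,₁ ≤ τₙ,₂ ≤ … ≤ τₙ,ₙ₊₂ₖ₋₁` of the grid `𝒯ₙ` in increasing order
(the index `j` starts at `1`). -/
def knot (k : ℕ) (t : ℕ → ℝ) (n j : ℕ) : ℝ :=
  ((gridPoints k t n).sort (· ≤ ·)).getD (j - 1) 0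

/-- The interval `D⁽ˡ⁾ₙ,ᵢ = [τₙ,ᵢ, τₙ,ᵢ₊ₗ]`. -/
def D (k : ℕ) (t : ℕ → ℝ) (l n i : ℕ) : Set ℝ :=
  Set.Icc (knot k t n i) (knot k t n (i + l))

/-- `l`-regularity with parameter `γ ≥ 1`: the lengths of neighbouring intervals `D⁽ˡ⁾ₙ,ᵢ` and
`D⁽ˡ⁾ₙ,ᵢ₊₁`, `k - l + 1 ≤ i ≤ n + k - 2`, have ratio at most `γ`. -/
def IsRegular (k l : ℕ) (γ : ℝ) (t : ℕ → ℝ) : Prop :=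
  1 ≤ γ ∧ ∀ n, 2 ≤ n → ∀ i, k - l + 1 ≤ i → i ≤ n + k - 2 →
    volume.real (D k t l n i) / γ ≤ volume.real (D k t l n (i + 1)) ∧
    volume.real (D k t l n (i + 1)) ≤ γ * volume.real (D k t l n i)

/-- The coefficient `αⱼ`, `i₀ - k ≤ j ≤ i₀`, where `τₙ,ᵢ₀` is the new knot of the grid `𝒯ₙ`. -/
def alpha (k : ℕ) (t : ℕ → ℝ) (n i₀ j : ℕ) : ℝ :=
  (-1) ^ (j + k - i₀) *
    (∏ l ∈ Finset.Icc (i₀ - k + 1) (j - 1),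
      (knot k t n i₀ - knot k t n l) / (knot k t n (l + k) - knot k t n l)) *
    (∏ l ∈ Finset.Icc (j + 1) (i₀ - 1),
      (knot k t n (l + k) - knot k t n i₀) / (knot k t n (l + k) - knot k t n l))

/-- The set `Λ⁽⁰⁾` of the indices `j ∈ [i₀ - k, i₀]` for which the B-spline support
`[τₙ,ⱼ, τₙ,ⱼ₊ₖ]` has length at most twice the minimal one (that is, at most twice the length of
each of them). -/
def Lambda0 (k : ℕ) (t : ℕ → ℝ) (n i₀ : ℕ) : Set ℕ :=
  {j | j ∈ Finset.Icc (i₀ - k) i₀ ∧ ∀ l ∈ Finset.Icc (i₀ - k) i₀,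
    volume.real (D k t k n j) ≤ 2 * volume.real (D k t k n l)}

/-- The set `Λ⁽¹⁾` of the indices in `Λ⁽⁰⁾` at which `|αⱼ|` is maximal. -/
def Lambda1 (k : ℕ) (t : ℕ → ℝ) (n i₀ : ℕ) : Set ℕ :=
  {j | j ∈ Lambda0 k t n i₀ ∧ ∀ l ∈ Lambda0 k t n i₀, |alpha k t n i₀ l| ≤ |alpha k t n i₀ j|}

/-- `I` is a possible choice of the characteristic interval `Jₙ` of the pair `(𝒯ₙ, 𝒯ₙ₋₁)`,
`n ≥ 2`: `τₙ,ᵢ₀ = t n` is the new knot of `𝒯ₙ`, `j` is some index in `Λ⁽¹⁾`, and `I` is one of the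
`k` grid intervals of `[τₙ,ⱼ, τₙ,ⱼ₊ₖ]` that has maximal length. -/
def IsCharInterval (k : ℕ) (t : ℕ → ℝ) (n : ℕ) (I : Set ℝ) : Prop :=
  ∃ i₀, k + 1 ≤ i₀ ∧ i₀ ≤ n + k - 1 ∧ knot k t n i₀ = t n ∧
    ∃ j ∈ Lambda1 k t n i₀, ∃ r < k, I = D k t 1 n (j + r) ∧
      ∀ s < k, volume.real (D k t 1 n (j + s)) ≤ volume.real (D k t 1 n (j + r))

open Classical in
/-- `card (V ∩ 𝒯ₙ)` with multiplicities, where each of the boundary points `0` and `1` is counted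
`k - 1` times: only the knots `τₙ,₂, …, τₙ,ₙ₊₂ₖ₋₂` are counted, which are the knots that occur
as end points of the intervals `D⁽ᵏ⁻¹⁾ₙ,ᵢ`, `2 ≤ i ≤ n + k - 1`. -/
def cardKnots (k : ℕ) (t : ℕ → ℝ) (n : ℕ) (V : Set ℝ) : ℕ :=
  ((Finset.Icc 2 (n + 2 * k - 2)).filter (fun j => knot k t n j ∈ V)).card

/-- The point `p` lies between the sets `V` and `I` (end points of both included). -/
def IsBetween (V I : Set ℝ) (p : ℝ) : Prop :=
  (∀ v ∈ V, ∀ x ∈ I, v ≤ p ∧ p ≤ x) ∨ (∀ v ∈ V, ∀ x ∈ I, x ≤ p ∧ p ≤ v)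

open Classical in
/-- `dₙ(V)` for a given interval `I = Jₙ`: the number of points of `𝒯ₙ` (with multiplicities)
between `V` and `I`, counting end points of both. -/
def gridDist (k : ℕ) (t : ℕ → ℝ) (n : ℕ) (I V : Set ℝ) : ℕ :=
  ((Finset.Icc 1 (n + 2 * k - 1)).filter (fun j => IsBetween V I (knot k t n j))).card

/-- The distance of two (non-empty) subsets of the real line. -/
def setDist (A B : Set ℝ) : ℝ :=
  sInf {r | ∃ a ∈ A, ∃ b ∈ B, r = |a - b|}

/-- The index set `N(Δ)`, for a given choice `J` of the characteristic intervals. -/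
def indexN (k : ℕ) (t : ℕ → ℝ) (J : ℕ → Set ℝ) (Δ : Set ℝ) : Set ℕ :=
  {n | 2 ≤ n ∧ cardKnots k t n Δ = k ∧ J n ⊆ Δ}

/-- The index set `M(Δ, l)`, for a given choice `J` of the characteristic intervals. -/
def indexM (k : ℕ) (t : ℕ → ℝ) (J : ℕ → Set ℝ) (Δ : Set ℝ) (l : ℕ) : Set ℕ :=
  {n | 2 ≤ n ∧ gridDist k t n (J n) Δ = l ∧ k ≤ cardKnots k t n Δ ∧ volume (J n ∩ Δ) = 0}

end

end SplineKnots

/-!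
Of a characteristic interval `J n` only the following matters (`IsCharInterval.exists_gap`): it is
a non-degenerate gap between neighbouring points of the grid `𝒯ₙ`, the new point `t n` is within
`k |J n|` of each of its points, and every support `[τ l, τ (l + k)]` around `t n` is at least half
as long as `J n`.

Consequently, at most `k (8 k + 1)` of the intervals `J n` with `y / 2 < |J n| ≤ y` contain a given
point (`card_charInterval_le`): the points `t n` for these `n` lie in an interval of length `2 k y`,
and if `k + 1` of them were in a cell of length `y / 4`, then, when the last of these is added,
there would be a support around it that is too short. Summing over dyadic lengths, the `J n` with a
common end point contribute at most a constant multiple of the longest of them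
(`sum_le_of_dyadic_card_le`).

For `N(Δ)`, the left end points of the `J n` are among the at most `k + 2` grid points in `Δ`, which
gives the first estimate (`sum_indexN_le`).

For `M(Δ, l)`, consider the `J n = [c, d]` to the right of `Δ = [a, b]`. As the grids increase and
the number of grid points between `b` and `c` is fixed, intervals with different left end points do
not overlap (`IsRegularGrid.gap_separated`). Regularity, applied along the chain of intervals from
`Δ` to `J n`, bounds `(d - c) / (c - a)` by `γ` and `d - b` by `(l + 1) γ ^ (l + 1) |Δ|`
(`gap_le_of_regular`, `far_end_le_of_regular`). The sum of `(d - c) / (c - a)` over the longest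
interval for each `c` is thus comparable to a sum of increments of `log (x - a)` over separated
intervals, and telescopes to a multiple of `l + 1` (`sum_div_le_log`). The intervals to the left of
`Δ` are reduced to this case by a reflection (`IsRegularGrid.reflect`).
-/

open MeasureTheory

namespace SplineKnots

/-! ### Sums of interval lengths -/

/-- If every dyadic layer `y / 2 < x n ≤ y` of a finite family of positive numbers has at most `F`
elements, then the sum of the family is dominated by a geometric series, hence by its maximum. -/
theorem sum_le_of_dyadic_card_le {ι : Type*} {x : ι → ℝ} {F : ℝ} (S : Finset ι)
    (hx : ∀ n ∈ S, 0 < x n)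
    (hF : ∀ y : ℝ, 0 < y → ((S.filter fun n => y / 2 < x n ∧ x n ≤ y).card : ℝ) ≤ F)
    {L : ℝ} (hL : 0 ≤ L) (hxL : ∀ n ∈ S, x n ≤ L) : ∑ n ∈ S, x n ≤ 2 * F * L := by
  classical
  induction S using Finset.strongInduction generalizing L with
  | H S ih =>
    have hF0 : 0 ≤ F := (Nat.cast_nonneg _).trans (hF 1 one_pos)
    rcases S.eq_empty_or_nonempty with rfl | hne
    · rw [Finset.sum_empty]
      positivity
    obtain ⟨m, hm, hmax⟩ := S.exists_max_image x hne
    have hxm := hx m hm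
    have hsub : (S.filter fun n => ¬ x m / 2 < x n) ⊂ S :=
      Finset.filter_ssubset.2 ⟨m, hm, by simpa using hxm⟩
    have hsmall := ih _ hsub (fun n hn => hx n (Finset.mem_filter.1 hn).1)
      (fun y hy => le_trans (by gcongr) (hF y hy))
      (L := x m / 2) (by positivity) (fun n hn => not_lt.1 (Finset.mem_filter.1 hn).2)
    have hlarge : ∑ n ∈ S with x m / 2 < x n, x n ≤ F * x m := by
      have hc : ((S.filter fun n => x m / 2 < x n).card : ℝ) ≤ F := by
        refine le_trans (le_of_eq ?_) (hF (x m) hxm)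
        congr 2
        exact Finset.filter_congr fun n hn => by simp [hmax n hn]
      calc ∑ n ∈ S with x m / 2 < x n, x n
          ≤ ∑ n ∈ S with x m / 2 < x n, x m :=
            Finset.sum_le_sum fun n hn => hmax n (Finset.mem_filter.1 hn).1
        _ = ((S.filter fun n => x m / 2 < x n).card : ℝ) * x m := by
            rw [Finset.sum_const, nsmul_eq_mul]
        _ ≤ F * x m := by gcongr
    rw [← Finset.sum_filter_add_sum_filter_not S (fun n => x m / 2 < x n)]
    have : F * x m ≤ F * L := by
      gcongr
      exact hxL m hm
    linarith

/-- The increments of a monotone function over successive intervals `[e, r e]` add up to at most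
its total increment. -/
theorem sum_increment_le {g : ℝ → ℝ} {b M : ℝ} (hbM : b ≤ M) (hg : MonotoneOn g (Set.Icc b M))
    {r : ℝ → ℝ} (E : Finset ℝ) (hb : ∀ e ∈ E, b ≤ e) (her : ∀ e ∈ E, e ≤ r e)
    (hrM : ∀ e ∈ E, r e ≤ M) (hsep : ∀ e ∈ E, ∀ e' ∈ E, e < e' → r e ≤ e') :
    ∑ e ∈ E, (g (r e) - g e) ≤ g M - g b := by
  induction E using Finset.induction_on_max generalizing M with
  | empty => simpa using hg ⟨le_rfl, hbM⟩ ⟨hbM, le_rfl⟩ hbM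
  | insert e E hmax ih =>
    have hbe := hb e (by simp)
    have hee := her e (by simp)
    have heM := hrM e (by simp)
    rw [Finset.sum_insert fun h => lt_irrefl _ (hmax e h)]
    have h1 := ih (M := e) hbe (hg.mono (Set.Icc_subset_Icc_right (hee.trans heM)))
      (fun x hx => hb x (by simp [hx])) (fun x hx => her x (by simp [hx]))
      (fun x hx => hsep x (by simp [hx]) e (by simp) (hmax x hx))
      (fun x hx x' hx' => hsep x (by simp [hx]) x' (by simp [hx']))
    have h2 := hg ⟨hbe.trans hee, heM⟩ ⟨hbM, le_rfl⟩ heM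
    linarith

/-- The logarithmic sum estimate for a family of intervals `[c n, d n]`. Intervals with a common
left end point contribute at most a multiple of the longest one; the longest ones are separated,
and `(d - c) / (c - a)` is comparable to the increment of `x ↦ log (x - a)` over `[c, d]`. -/
theorem sum_div_le_log {c d : ℕ → ℝ} {a b γ K F : ℝ} (P : Finset ℕ) (hab : a < b) (hγ : 0 ≤ γ)
    (hK : 1 ≤ K) (hbc : ∀ n ∈ P, b ≤ c n) (hcd : ∀ n ∈ P, c n < d n)
    (hlen : ∀ n ∈ P, d n - c n ≤ γ * (c n - a)) (hfar : ∀ n ∈ P, d n - a ≤ K * (b - a))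
    (hsep : ∀ n ∈ P, ∀ n' ∈ P, c n < c n' → d n ≤ c n')
    (hF : ∀ e y : ℝ, 0 < y →
      ((P.filter fun n => c n = e ∧ y / 2 < d n - c n ∧ d n - c n ≤ y).card : ℝ) ≤ F) :
    ∑ n ∈ P, (d n - c n) / (c n - a) ≤ 2 * F * ((1 + γ) * Real.log K) := by
  classical
  have hF0 : 0 ≤ F := (Nat.cast_nonneg _).trans (hF 0 1 one_pos)
  have hex : ∀ e ∈ P.image c, ∃ n ∈ P, c n = e ∧ ∀ n' ∈ P, c n' = e → d n' ≤ d n := by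
    intro e he
    obtain ⟨n, hn, rfl⟩ := Finset.mem_image.1 he
    obtain ⟨m, hm, hmax⟩ := (P.filter fun n' => c n' = c n).exists_max_image d
      ⟨n, by simp [hn]⟩
    rw [Finset.mem_filter] at hm
    exact ⟨m, hm.1, hm.2, fun n' h h' => hmax n' (by simp [h, h'])⟩
  choose! s hsP hsc hsmax using hex
  have hpos : ∀ e ∈ P.image c, 0 < e - a := by
    intro e he
    have := hbc _ (hsP e he)
    rw [hsc e he] at this
    linarith
  have hgroup : ∀ e ∈ P.image c, ∑ n ∈ P with c n = e, (d n - c n) / (c n - a) ≤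
      2 * F * ((1 + γ) * (Real.log (d (s e) - a) - Real.log (e - a))) := by
    intro e he
    have hea := hpos e he
    have hes := hcd _ (hsP e he)
    have hle := hlen _ (hsP e he)
    rw [hsc e he] at hes hle
    have h1 : ∑ n ∈ P with c n = e, (d n - c n) ≤ 2 * F * (d (s e) - e) := by
      refine sum_le_of_dyadic_card_le _ ?_ ?_ (by linarith) ?_
      · intro n hn
        linarith [hcd n (Finset.mem_filter.1 hn).1]
      · intro y hy
        rw [Finset.filter_filter]
        exact hF e y hy
      · intro n hn
        rw [Finset.mem_filter] at hn
        linarith [hsmax e he n hn.1 hn.2, hn.2]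
    have h2 : ∑ n ∈ P with c n = e, (d n - c n) / (c n - a) =
        (∑ n ∈ P with c n = e, (d n - c n)) / (e - a) := by
      rw [Finset.sum_div]
      exact Finset.sum_congr rfl fun n hn => by rw [(Finset.mem_filter.1 hn).2]
    have hda : 0 < d (s e) - a := by linarith
    -- `log (1 + u) ≥ u / (1 + u) ≥ u / (1 + γ)` with `u = (d - c) / (c - a) ≤ γ`
    have h3 : (d (s e) - e) / (e - a) ≤
        (1 + γ) * (Real.log (d (s e) - a) - Real.log (e - a)) := by
      rw [← Real.log_div hda.ne' hea.ne']
      have h4 := Real.one_sub_inv_le_log_of_pos (div_pos hda hea)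
      have h5 : (d (s e) - e) / (e - a) ≤ (1 + γ) * (1 - ((d (s e) - a) / (e - a))⁻¹) := by
        rw [inv_div, one_sub_div hda.ne', ← mul_div_assoc, div_le_div_iff₀ hea hda]
        have : d (s e) - a ≤ (1 + γ) * (e - a) := by linarith
        nlinarith
      exact h5.trans (by gcongr)
    rw [h2, div_le_iff₀ hea]
    rw [div_le_iff₀ hea] at h3
    calc _ ≤ 2 * F * (d (s e) - e) := h1
      _ ≤ 2 * F * ((1 + γ) * (Real.log (d (s e) - a) - Real.log (e - a)) * (e - a)) := by gcongr
      _ = _ := by ring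
  have htel : ∑ e ∈ P.image c, (Real.log (d (s e) - a) - Real.log (e - a)) ≤ Real.log K := by
    have hba : 0 < b - a := sub_pos.2 hab
    have h := sum_increment_le (g := fun x => Real.log (x - a)) (b := b) (M := a + K * (b - a))
      (r := fun e => d (s e)) (by nlinarith)
      (fun x hx y _ hxy => Real.log_le_log (by linarith [hx.1]) (by linarith)) (P.image c)
      (fun e he => by have := hbc _ (hsP e he); rwa [hsc e he] at this)
      (fun e he => by have := (hcd _ (hsP e he)).le; rwa [hsc e he] at this)
      (fun e he => by linarith [hfar _ (hsP e he)])
      (fun e he e' he' hlt => by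
        have := hsep _ (hsP e he) _ (hsP e' he')
        rw [hsc e he, hsc e' he'] at this
        exact this hlt)
    refine h.trans (le_of_eq ?_)
    simp only [add_sub_cancel_left]
    rw [Real.log_mul (by linarith) hba.ne', add_sub_cancel_right]
  calc ∑ n ∈ P, (d n - c n) / (c n - a)
      = ∑ e ∈ P.image c, ∑ n ∈ P with c n = e, (d n - c n) / (c n - a) :=
        (Finset.sum_fiberwise_of_maps_to (fun n hn => Finset.mem_image_of_mem c hn) _).symm
    _ ≤ ∑ e ∈ P.image c,
        2 * F * ((1 + γ) * (Real.log (d (s e) - a) - Real.log (e - a))) :=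
        Finset.sum_le_sum hgroup
    _ = 2 * F * ((1 + γ) *
        ∑ e ∈ P.image c, (Real.log (d (s e) - a) - Real.log (e - a))) := by
        rw [Finset.mul_sum, Finset.mul_sum]
    _ ≤ _ := by gcongr

/-! ### Regular families of grids -/

/-- The number of indices `1 ≤ j ≤ n + 2 k - 1` for which the point `σ j` lies in `A`; for the
knots `σ = knot k t n` this counts the points of `𝒯ₙ` in `A` with multiplicities. -/
noncomputable def gridCount (k n : ℕ) (σ : ℕ → ℝ) (A : Set ℝ) : ℕ := by
  classical
  exact ((Finset.Icc 1 (n + 2 * k - 1)).filter fun j => σ j ∈ A).card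

/-- The properties of the knots of a `(k - 1)`-regular sequence that matter for counting: `τ n`
enumerates the `n + 2 k - 1` points of the `n`-th grid in increasing order, the grids are nested as
multisets, and neighbouring intervals spanned by `k` successive points are comparable. Unlike the
knots themselves, this notion is invariant under reflection of the line. -/
structure IsRegularGrid (k : ℕ) (γ : ℝ) (τ : ℕ → ℕ → ℝ) : Prop where
  mono : ∀ n, 2 ≤ n → MonotoneOn (τ n) (Set.Icc 1 (n + 2 * k - 1))
  count_le : ∀ n n', 2 ≤ n → n ≤ n' → ∀ A : Set ℝ,
    gridCount k n (τ n) A ≤ gridCount k n' (τ n') A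
  ratio_le : ∀ n, 2 ≤ n → ∀ i, 2 ≤ i → i ≤ n + k - 2 →
    τ n (i + k) - τ n (i + 1) ≤ γ * (τ n (i + k - 1) - τ n i)
  ratio_ge : ∀ n, 2 ≤ n → ∀ i, 2 ≤ i → i ≤ n + k - 2 →
    τ n (i + k - 1) - τ n i ≤ γ * (τ n (i + k) - τ n (i + 1))

theorem gridCount_lt (k n : ℕ) (σ : ℕ → ℝ) {A B : Set ℝ} (h : A ⊆ B) {j : ℕ} (hj1 : 1 ≤ j)
    (hj2 : j ≤ n + 2 * k - 1) (hjA : σ j ∉ A) (hjB : σ j ∈ B) :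
    gridCount k n σ A < gridCount k n σ B := by
  classical
  unfold gridCount
  refine Finset.card_lt_card ⟨Finset.monotone_filter_right _ fun j _ hj => h hj, fun h' => ?_⟩
  have := h' (Finset.mem_filter.2 ⟨Finset.mem_Icc.2 ⟨hj1, hj2⟩, hjB⟩)
  exact hjA (Finset.mem_filter.1 this).2

theorem gridCount_pos_iff (k n : ℕ) (σ : ℕ → ℝ) (A : Set ℝ) :
    0 < gridCount k n σ A ↔ ∃ j, 1 ≤ j ∧ j ≤ n + 2 * k - 1 ∧ σ j ∈ A := by
  classical
  simp [gridCount, Finset.card_pos, Finset.Nonempty, and_assoc]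

/-- Grid points persist in later grids. -/
theorem exists_eq_of_gridCount_le {k n n' : ℕ} {σ σ' : ℕ → ℝ}
    (h : ∀ A : Set ℝ, gridCount k n σ A ≤ gridCount k n' σ' A) {j : ℕ} (hj1 : 1 ≤ j)
    (hj2 : j ≤ n + 2 * k - 1) : ∃ j', 1 ≤ j' ∧ j' ≤ n' + 2 * k - 1 ∧ σ' j' = σ j := by
  have h1 : 0 < gridCount k n σ {σ j} := (gridCount_pos_iff ..).2 ⟨j, hj1, hj2, rfl⟩
  simpa using (gridCount_pos_iff ..).1 (h1.trans_le (h _))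

theorem card_filter_Icc_reflect (lo s : ℕ) (hlo : lo ≤ s) (p : ℕ → Prop) [DecidablePred p] :
    ((Finset.Icc lo (s - lo)).filter fun j => p (s - j)).card =
      ((Finset.Icc lo (s - lo)).filter p).card := by
  refine Finset.card_nbij' (fun j => s - j) (fun j => s - j) ?_ ?_ ?_ ?_
  · intro j hj
    simp only [Finset.coe_filter, Finset.mem_Icc, Set.mem_ofPred_eq] at hj ⊢
    exact ⟨by omega, hj.2⟩
  · intro j hj
    simp only [Finset.coe_filter, Finset.mem_Icc, Set.mem_ofPred_eq] at hj ⊢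
    refine ⟨by omega, ?_⟩
    rw [show s - (s - j) = j by omega]
    exact hj.2
  · intro j hj
    simp only [Finset.coe_filter, Finset.mem_Icc, Set.mem_ofPred_eq] at hj
    exact Nat.sub_sub_self (by omega)
  · intro j hj
    simp only [Finset.coe_filter, Finset.mem_Icc, Set.mem_ofPred_eq] at hj
    exact Nat.sub_sub_self (by omega)

theorem gridCount_reflect (k n : ℕ) (hk : 1 ≤ k) (σ : ℕ → ℝ) (A : Set ℝ) :
    gridCount k n (fun j => -σ (n + 2 * k - j)) A = gridCount k n σ {x | -x ∈ A} := by
  classical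
  exact card_filter_Icc_reflect 1 (n + 2 * k) (by omega) (fun j => -σ j ∈ A)

theorem IsRegularGrid.reflect {k : ℕ} {γ : ℝ} {τ : ℕ → ℕ → ℝ} (hk : 2 ≤ k)
    (h : IsRegularGrid k γ τ) : IsRegularGrid k γ fun n j => -τ n (n + 2 * k - j) where
  mono n hn i hi j hj hij := by
    simp only [Set.mem_Icc] at hi hj
    exact neg_le_neg (h.mono n hn ⟨by omega, by omega⟩ ⟨by omega, by omega⟩ (by omega))
  count_le n n' hn hnn' A := by
    rw [gridCount_reflect k n (by omega), gridCount_reflect k n' (by omega)]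
    exact h.count_le n n' hn hnn' _
  ratio_le n hn i hi hi' := by
    have := h.ratio_ge n hn (n + k - i) (by omega) (by omega)
    rw [show n + k - i + k - 1 = n + 2 * k - (i + 1) by omega,
      show n + k - i + k = n + 2 * k - i by omega,
      show n + k - i = n + 2 * k - (i + k) by omega,
      show n + 2 * k - (i + k) + 1 = n + 2 * k - (i + k - 1) by omega] at this
    linarith
  ratio_ge n hn i hi hi' := by
    have := h.ratio_le n hn (n + k - i) (by omega) (by omega)
    rw [show n + k - i + k - 1 = n + 2 * k - (i + 1) by omega,
      show n + k - i + k = n + 2 * k - i by omega,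
      show n + k - i = n + 2 * k - (i + k) by omega,
      show n + 2 * k - (i + k) + 1 = n + 2 * k - (i + k - 1) by omega] at this
    linarith

section SingleGrid

variable {k n q : ℕ} {γ a b : ℝ} {σ : ℕ → ℝ}

open Classical in
/-- If `[a, b]` contains at least `k` of the inner points and lies to the left of the gap
`[σ q, σ (q + 1)]`, then its last `k` points have the successive indices `r + 1 - k, …, r`. -/
theorem exists_last_index (hk : 2 ≤ k) (hσ : MonotoneOn σ (Set.Icc 1 (n + 2 * k - 1)))
    (hq1 : 2 ≤ q) (hq2 : q + 3 ≤ n + 2 * k) (hqq : σ q < σ (q + 1)) (hbq : b ≤ σ q)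
    (hcard : k ≤ ((Finset.Icc 2 (n + 2 * k - 2)).filter fun j => σ j ∈ Set.Icc a b).card) :
    ∃ r, k + 1 ≤ r ∧ r ≤ q ∧ a ≤ σ (r + 1 - k) ∧ σ r ≤ b ∧
      ∀ j, r < j → j ≤ n + 2 * k - 2 → b < σ j := by
  set S := (Finset.Icc 2 (n + 2 * k - 2)).filter fun j => σ j ∈ Set.Icc a b with hS
  have hne : S.Nonempty := Finset.card_pos.1 (by omega)
  have hp := S.min'_mem hne
  have hr := S.max'_mem hne
  set p := S.min' hne with hpdef
  set r := S.max' hne with hrdef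
  have hsub : S ⊆ Finset.Icc p r :=
    fun j hj => Finset.mem_Icc.2 ⟨S.min'_le j hj, S.le_max' j hj⟩
  have hc := Finset.card_le_card hsub
  rw [Nat.card_Icc] at hc
  simp only [hS, Finset.mem_filter, Finset.mem_Icc, Set.mem_Icc] at hp hr
  refine ⟨r, by omega, ?_, ?_, hr.2.2, ?_⟩
  · by_contra! hlt
    have := hσ (a := q + 1) (b := r) ⟨by omega, by omega⟩ ⟨by omega, by omega⟩ hlt
    linarith [hr.2.2]
  · exact hp.2.1.trans (hσ ⟨by omega, by omega⟩ ⟨by omega, by omega⟩ (by omega))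
  · intro j hrj hj
    by_contra! hjb
    have hra := hσ (a := r) (b := j) ⟨by omega, by omega⟩ ⟨by omega, by omega⟩ hrj.le
    have : j ∈ S := by
      simp only [hS, Finset.mem_filter, Finset.mem_Icc, Set.mem_Icc]
      exact ⟨⟨by omega, hj⟩, hr.2.1.trans hra, hjb⟩
    have := S.le_max' j this
    omega

open Classical in
/-- By regularity, a gap to the right of `[a, b]` is not much longer than its distance from `a`. -/
theorem gap_le_of_regular (hk : 2 ≤ k) (hσ : MonotoneOn σ (Set.Icc 1 (n + 2 * k - 1)))
    (hγ : 1 ≤ γ)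
    (hreg : ∀ i, 2 ≤ i → i ≤ n + k - 2 → σ (i + k) - σ (i + 1) ≤ γ * (σ (i + k - 1) - σ i))
    (hq1 : 2 ≤ q) (hq2 : q + 3 ≤ n + 2 * k) (hqq : σ q < σ (q + 1)) (hbq : b ≤ σ q)
    (hcard : k ≤ ((Finset.Icc 2 (n + 2 * k - 2)).filter fun j => σ j ∈ Set.Icc a b).card) :
    σ (q + 1) - σ q ≤ γ * (σ q - a) := by
  obtain ⟨r, hr1, hrq, har, -, -⟩ := exists_last_index hk hσ hq1 hq2 hqq hbq hcard
  have h1 := hreg (q + 1 - k) (by omega) (by omega)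
  rw [show q + 1 - k + k = q + 1 by omega, show q + 1 - 1 = q by omega] at h1
  have h2 := hσ (a := q + 1 - k + 1) (b := q) ⟨by omega, by omega⟩ ⟨by omega, by omega⟩ (by omega)
  have h3 := hσ (a := r + 1 - k) (b := q + 1 - k) ⟨by omega, by omega⟩ ⟨by omega, by omega⟩
    (by omega)
  have h4 : γ * (σ q - σ (q + 1 - k)) ≤ γ * (σ q - a) := by
    gcongr
    linarith
  linarith

open Classical in
/-- By regularity, a gap at grid distance `ℓ` from `[a, b]` is at a distance of at most
`(ℓ + 1) γ ^ (ℓ + 1) (b - a)`. -/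
theorem far_end_le_of_regular (hk : 2 ≤ k) (hσ : MonotoneOn σ (Set.Icc 1 (n + 2 * k - 1)))
    (hγ : 1 ≤ γ)
    (hreg : ∀ i, 2 ≤ i → i ≤ n + k - 2 → σ (i + k) - σ (i + 1) ≤ γ * (σ (i + k - 1) - σ i))
    (hab : a ≤ b) (hq1 : 2 ≤ q) (hq2 : q + 3 ≤ n + 2 * k) (hqq : σ q < σ (q + 1)) (hbq : b ≤ σ q)
    (hcard : k ≤ ((Finset.Icc 2 (n + 2 * k - 2)).filter fun j => σ j ∈ Set.Icc a b).card)
    {ℓ : ℕ} (hℓ : gridCount k n σ (Set.Icc b (σ q)) = ℓ) :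
    σ (q + 1) - b ≤ (ℓ + 1) * γ ^ (ℓ + 1) * (b - a) := by
  obtain ⟨r, hr1, hrq, har, hrb, hlast⟩ := exists_last_index hk hσ hq1 hq2 hqq hbq hcard
  have hba : 0 ≤ b - a := sub_nonneg.2 hab
  have hwin : ∀ s, r + s ≤ q + 1 → σ (r + s) - σ (r + s + 1 - k) ≤ γ ^ s * (b - a) := by
    intro s
    induction s with
    | zero =>
      intro _
      simp only [add_zero, pow_zero, one_mul]
      linarith
    | succ s ih =>
      intro hs
      have h1 := hreg (r + s + 1 - k) (by omega) (by omega)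
      rw [show r + s + 1 - k + k = r + (s + 1) by omega,
        show r + (s + 1) - 1 = r + s by omega,
        show r + s + 1 - k + 1 = r + (s + 1) + 1 - k by omega] at h1
      calc _ ≤ γ * (σ (r + s) - σ (r + s + 1 - k)) := h1
        _ ≤ γ * (γ ^ s * (b - a)) := by
          gcongr
          exact ih (by omega)
        _ = _ := by ring
  have hend : ∀ s : ℕ, r + s ≤ q + 1 → σ (r + s) - b ≤ s * γ ^ s * (b - a) := by
    intro s
    induction s with
    | zero =>
      intro _
      simpa using hrb
    | succ s ih =>
      intro hs
      have h1 := ih (by omega)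
      have h2 := hwin (s + 1) hs
      have h3 := hσ (a := r + (s + 1) + 1 - k) (b := r + s) ⟨by omega, by omega⟩
        ⟨by omega, by omega⟩ (by omega)
      have h4 : (s : ℝ) * γ ^ s * (b - a) ≤ s * γ ^ (s + 1) * (b - a) := by
        gcongr
        omega
      push_cast
      linarith
  have hrl : q - r ≤ ℓ := by
    rw [← hℓ, ← Nat.card_Ioc]
    unfold gridCount
    refine Finset.card_le_card fun j hj => ?_
    rw [Finset.mem_Ioc] at hj
    simp only [Finset.mem_filter]
    exact ⟨Finset.mem_Icc.2 ⟨by omega, by omega⟩, (hlast j hj.1 (by omega)).le,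
      hσ ⟨by omega, by omega⟩ ⟨by omega, by omega⟩ hj.2⟩
  have h := hend (q + 1 - r) (by omega)
  rw [show r + (q + 1 - r) = q + 1 by omega] at h
  refine h.trans ?_
  have : ((q + 1 - r : ℕ) : ℝ) ≤ ℓ + 1 := by
    exact_mod_cast (by omega : q + 1 - r ≤ ℓ + 1)
  gcongr
  omega

end SingleGrid

/-- Of two gaps at the same grid distance to the right of `b`, chosen in different grids, the one
that starts further to the right belongs to the earlier grid, and they do not overlap. -/
theorem IsRegularGrid.gap_separated {k : ℕ} {γ : ℝ} {τ : ℕ → ℕ → ℝ} (h : IsRegularGrid k γ τ)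
    {b : ℝ} {n n' q q' : ℕ} (hn : 2 ≤ n) (hn' : 2 ≤ n') (hq1 : 1 ≤ q)
    (hq2 : q + 1 ≤ n + 2 * k - 1) (hq1' : 1 ≤ q') (hq2' : q' ≤ n' + 2 * k - 1)
    (hbq : b ≤ τ n q)
    (hℓ : gridCount k n (τ n) (Set.Icc b (τ n q)) = gridCount k n' (τ n') (Set.Icc b (τ n' q')))
    (hlt : τ n q < τ n' q') : τ n (q + 1) ≤ τ n' q' := by
  rcases le_total n n' with hle | hle
  · have h1 := h.count_le n n' hn hle (Set.Icc b (τ n q))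
    have h2 := gridCount_lt k n' (τ n') (Set.Icc_subset_Icc_right hlt.le) hq1' hq2'
      (fun hm => absurd hm.2 (not_le.2 hlt)) ⟨hbq.trans hlt.le, le_refl (τ n' q')⟩
    omega
  · obtain ⟨j, hj1, hj2, hj⟩ := exists_eq_of_gridCount_le (h.count_le n' n hn' hle) hq1' hq2'
    rw [← hj] at hlt ⊢
    have : q < j := by
      by_contra! hjq
      exact absurd (h.mono n hn ⟨hj1, hj2⟩ ⟨hq1, by omega⟩ hjq) (not_le.2 hlt)
    exact h.mono n hn ⟨by omega, hq2⟩ ⟨hj1, hj2⟩ this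

open Classical in
/-- The sum over gaps to the right of `[a, b]`, all at the same grid distance `ℓ`: they lie within
`(ℓ + 1) γ ^ (ℓ + 1) (b - a)` of `b`, so that the logarithmic estimate is linear in `ℓ + 1`. The
weights `w` are arbitrary majorants of the distance from `a`. -/
theorem IsRegularGrid.sum_right_le {k : ℕ} {γ : ℝ} {τ : ℕ → ℕ → ℝ} (h : IsRegularGrid k γ τ)
    (hk : 2 ≤ k) (hγ : 1 ≤ γ) {a b F : ℝ} (hab : a ≤ b) {ℓ : ℕ} {q : ℕ → ℕ}
    {w : ℕ → ℝ} (P : Finset ℕ)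
    (hn : ∀ n ∈ P, 2 ≤ n) (hq1 : ∀ n ∈ P, 2 ≤ q n) (hq2 : ∀ n ∈ P, q n + 3 ≤ n + 2 * k)
    (hqq : ∀ n ∈ P, τ n (q n) < τ n (q n + 1)) (hbq : ∀ n ∈ P, b ≤ τ n (q n))
    (hcard : ∀ n ∈ P,
      k ≤ ((Finset.Icc 2 (n + 2 * k - 2)).filter fun j => τ n j ∈ Set.Icc a b).card)
    (hℓ : ∀ n ∈ P, gridCount k n (τ n) (Set.Icc b (τ n (q n))) = ℓ)
    (hF : ∀ e y : ℝ, 0 < y → ((P.filter fun n => τ n (q n) = e ∧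
      y / 2 < τ n (q n + 1) - τ n (q n) ∧ τ n (q n + 1) - τ n (q n) ≤ y).card : ℝ) ≤ F)
    (hw : ∀ n ∈ P, τ n (q n) - a ≤ w n) :
    ∑ n ∈ P, (τ n (q n + 1) - τ n (q n)) / w n ≤
      2 * F * ((1 + γ) * ((ℓ + 1) * γ)) := by
  have hF0 : 0 ≤ F := (Nat.cast_nonneg _).trans (hF 0 1 one_pos)
  rcases P.eq_empty_or_nonempty with rfl | ⟨m, hm⟩
  · rw [Finset.sum_empty]
    positivity
  have hfar : ∀ n ∈ P, τ n (q n + 1) - b ≤ (ℓ + 1) * γ ^ (ℓ + 1) * (b - a) := fun n hnP =>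
    far_end_le_of_regular hk (h.mono n (hn n hnP)) hγ (h.ratio_le n (hn n hnP)) hab
      (hq1 n hnP) (hq2 n hnP) (hqq n hnP) (hbq n hnP) (hcard n hnP) (hℓ n hnP)
  -- a degenerate interval `[a, b]` has no gaps of positive length at finite grid distance
  have hab' : a < b := by
    refine hab.lt_of_ne ?_
    rintro rfl
    have := hfar m hm
    rw [sub_self, mul_zero] at this
    linarith [hqq m hm, hbq m hm]
  have hγ1 : 1 ≤ γ ^ (ℓ + 1) := one_le_pow₀ hγ
  have hsum := sum_div_le_log (c := fun n => τ n (q n)) (d := fun n => τ n (q n + 1))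
    (a := a) (b := b) (γ := γ) (K := (ℓ + 2) * γ ^ (ℓ + 1)) (F := F) P hab' (by linarith)
    (by nlinarith [(Nat.cast_nonneg ℓ : (0 : ℝ) ≤ ℓ)]) hbq hqq
    (fun n hnP => gap_le_of_regular hk (h.mono n (hn n hnP)) hγ (h.ratio_le n (hn n hnP))
      (hq1 n hnP) (hq2 n hnP) (hqq n hnP) (hbq n hnP) (hcard n hnP))
    (fun n hnP => by nlinarith [hfar n hnP])
    (fun n hnP n' hnP' hlt => by
      have h1 := hq1 n hnP
      have h2 := hq2 n hnP
      have h1' := hq1 n' hnP'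
      have h2' := hq2 n' hnP'
      exact h.gap_separated (hn n hnP) (hn n' hnP') (by omega) (by omega) (by omega) (by omega)
        (hbq n hnP) ((hℓ n hnP).trans (hℓ n' hnP').symm) hlt)
    hF
  have hweight : ∑ n ∈ P, (τ n (q n + 1) - τ n (q n)) / w n ≤
      ∑ n ∈ P, (τ n (q n + 1) - τ n (q n)) / (τ n (q n) - a) :=
    Finset.sum_le_sum fun n hnP => div_le_div_of_nonneg_left
      (sub_pos.2 (hqq n hnP)).le (by linarith [hbq n hnP]) (hw n hnP)
  refine hweight.trans (hsum.trans ?_)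
  have hlog : Real.log ((ℓ + 2) * γ ^ (ℓ + 1)) ≤ (ℓ + 1) * γ := by
    rw [Real.log_mul (by positivity) (by positivity), Real.log_pow]
    have h1 := Real.log_le_sub_one_of_pos (show (0 : ℝ) < ℓ + 2 by positivity)
    have h2 := Real.log_le_sub_one_of_pos (show 0 < γ by linarith)
    have h3 : ((ℓ : ℝ) + 1) * Real.log γ ≤ (ℓ + 1) * (γ - 1) := by gcongr
    push_cast
    linarith
  gcongr

open Classical in
/-- The mirror image of `IsRegularGrid.sum_right_le`. -/
theorem IsRegularGrid.sum_left_le {k : ℕ} {γ : ℝ} {τ : ℕ → ℕ → ℝ} (h : IsRegularGrid k γ τ)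
    (hk : 2 ≤ k) (hγ : 1 ≤ γ) {a b F : ℝ} (hab : a ≤ b) {ℓ : ℕ} {q : ℕ → ℕ}
    {w : ℕ → ℝ} (P : Finset ℕ)
    (hn : ∀ n ∈ P, 2 ≤ n) (hq1 : ∀ n ∈ P, 2 ≤ q n) (hq2 : ∀ n ∈ P, q n + 3 ≤ n + 2 * k)
    (hqq : ∀ n ∈ P, τ n (q n) < τ n (q n + 1)) (haq : ∀ n ∈ P, τ n (q n + 1) ≤ a)
    (hcard : ∀ n ∈ P,
      k ≤ ((Finset.Icc 2 (n + 2 * k - 2)).filter fun j => τ n j ∈ Set.Icc a b).card)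
    (hℓ : ∀ n ∈ P, gridCount k n (τ n) (Set.Icc (τ n (q n + 1)) a) = ℓ)
    (hF : ∀ e y : ℝ, 0 < y → ((P.filter fun n => τ n (q n + 1) = e ∧
      y / 2 < τ n (q n + 1) - τ n (q n) ∧ τ n (q n + 1) - τ n (q n) ≤ y).card : ℝ) ≤ F)
    (hw : ∀ n ∈ P, b - τ n (q n + 1) ≤ w n) :
    ∑ n ∈ P, (τ n (q n + 1) - τ n (q n)) / w n ≤
      2 * F * ((1 + γ) * ((ℓ + 1) * γ)) := by
  have e1 : ∀ n ∈ P, n + 2 * k - (n + 2 * k - 1 - q n) = q n + 1 := fun n hnP => by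
    have := hq2 n hnP
    omega
  have e2 : ∀ n ∈ P, n + 2 * k - (n + 2 * k - 1 - q n + 1) = q n := fun n hnP => by
    have := hq2 n hnP
    omega
  have key := (h.reflect hk).sum_right_le hk hγ (neg_le_neg hab) (F := F) (ℓ := ℓ) (w := w)
    (q := fun n => n + 2 * k - 1 - q n) P hn
    (fun n hnP => by have := hq2 n hnP; omega) (fun n hnP => by have := hq1 n hnP; omega)
    (fun n hnP => by
      simp only [e1 n hnP, e2 n hnP]
      exact neg_lt_neg (hqq n hnP))
    (fun n hnP => by
      simp only [e1 n hnP]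
      exact neg_le_neg (haq n hnP))
    (fun n hnP => by
      refine (hcard n hnP).trans (le_of_eq ?_)
      have := card_filter_Icc_reflect 2 (n + 2 * k) (by omega)
        (fun j => -τ n j ∈ Set.Icc (-b) (-a))
      rw [this]
      congr 1
      refine Finset.filter_congr fun j _ => ?_
      simp only [Set.mem_Icc, neg_le_neg_iff]
      exact and_comm)
    (fun n hnP => by
      rw [gridCount_reflect k n (by omega), ← hℓ n hnP]
      congr 1
      ext x
      simp only [e1 n hnP, Set.mem_ofPred_eq, Set.mem_Icc, neg_le_neg_iff]
      exact and_comm)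
    (fun e y hy => by
      refine le_trans (le_of_eq ?_) (hF (-e) y hy)
      congr 2
      refine Finset.filter_congr fun n hnP => ?_
      simp only [e1 n hnP, e2 n hnP, neg_eq_iff_eq_neg]
      rw [neg_sub_neg])
    (fun n hnP => by
      rw [e1 n hnP, neg_sub_neg]
      exact hw n hnP)
  refine le_trans (le_of_eq (Finset.sum_congr rfl fun n hnP => ?_)) key
  rw [e1 n hnP, e2 n hnP, neg_sub_neg]

/-! ### The knots of an admissible sequence -/

theorem card_gridPoints (k : ℕ) (t : ℕ → ℝ) {n : ℕ} (hn : 2 ≤ n) :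
    (gridPoints k t n).card = n + 2 * k - 1 := by
  simp [gridPoints]
  omega

theorem map_knot (k : ℕ) (t : ℕ → ℝ) {n : ℕ} (hn : 2 ≤ n) :
    (Finset.Icc 1 (n + 2 * k - 1)).val.map (knot k t n) = gridPoints k t n := by
  set l := (gridPoints k t n).sort (· ≤ ·) with hl
  have hlen : l.length = n + 2 * k - 1 := by
    rw [hl, Multiset.length_sort, card_gridPoints k t hn]
  have hI : (Finset.Icc 1 (n + 2 * k - 1)).val = ((List.range l.length).map (· + 1) : List ℕ) := by
    have h : Finset.Icc 1 (n + 2 * k - 1) =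
        (Finset.range (n + 2 * k - 1)).map (addRightEmbedding 1) := by
      ext j
      simp only [Finset.mem_Icc, Finset.mem_map, Finset.mem_range, addRightEmbedding_apply]
      exact ⟨fun h => ⟨j - 1, by omega, by omega⟩, by omega⟩
    rw [h, hlen]
    rfl
  rw [hI, Multiset.map_coe, List.map_map, ← Multiset.sort_eq (gridPoints k t n) (· ≤ ·), ← hl]
  congr 1
  refine List.ext_getElem (by simp) fun j h1 h2 => ?_
  simp [knot, ← hl, h2]

theorem knot_monotoneOn (k : ℕ) (t : ℕ → ℝ) {n : ℕ} (hn : 2 ≤ n) :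
    MonotoneOn (knot k t n) (Set.Icc 1 (n + 2 * k - 1)) := by
  intro i hi j hj hij
  have hlen : ((gridPoints k t n).sort (· ≤ ·)).length = n + 2 * k - 1 := by
    rw [Multiset.length_sort, card_gridPoints k t hn]
  have hs : ((gridPoints k t n).sort (· ≤ ·)).SortedLE := (Multiset.pairwise_sort _ _).sortedLE
  simp only [Set.mem_Icc] at hi hj
  unfold knot
  rw [List.getD_eq_getElem _ _ (by omega), List.getD_eq_getElem _ _ (by omega)]
  exact hs.getElem_le_getElem_of_le (by omega)

open Classical in
theorem gridCount_knot (k : ℕ) (t : ℕ → ℝ) {n : ℕ} (hn : 2 ≤ n) (A : Set ℝ) :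
    gridCount k n (knot k t n) A = (gridPoints k t n).countP (· ∈ A) := by
  rw [← map_knot k t hn, Multiset.countP_map]
  rfl

theorem gridCount_knot_le (k : ℕ) (t : ℕ → ℝ) {n n' : ℕ} (hn : 2 ≤ n) (h : n ≤ n') (A : Set ℝ) :
    gridCount k n (knot k t n) A ≤ gridCount k n' (knot k t n') A := by
  classical
  rw [gridCount_knot k t hn, gridCount_knot k t (hn.trans h)]
  refine Multiset.countP_le_of_le _ ?_
  unfold gridPoints
  gcongr
  exact Finset.val_le_iff.2 (Finset.Icc_subset_Icc_right h)

theorem card_filter_le_gridCount_knot (k : ℕ) (t : ℕ → ℝ) {n : ℕ} (hn : 2 ≤ n) (A : Set ℝ)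
    (S : Finset ℕ) (hS : ∀ m ∈ S, 2 ≤ m ∧ m ≤ n ∧ t m ∈ A) :
    S.card ≤ gridCount k n (knot k t n) A := by
  classical
  rw [gridCount_knot k t hn, gridPoints, Multiset.countP_add, Multiset.countP_map]
  refine le_trans ?_ (Nat.le_add_left _ _)
  exact Finset.card_le_card (t := (Finset.Icc 2 n).filter fun m => t m ∈ A) fun m hm => by
    have := hS m hm
    simp [this]

theorem countP_replicate_singleton (k : ℕ) (a x : ℝ) [DecidablePred (· ∈ ({x} : Set ℝ))] :
    (Multiset.replicate k a).countP (· ∈ ({x} : Set ℝ)) = if a = x then k else 0 := by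
  rw [← Multiset.coe_replicate, Multiset.coe_countP, List.countP_replicate]
  simp

theorem IsAdmissible.gridCount_singleton_le {k : ℕ} {t : ℕ → ℝ} (ht : IsAdmissible k t) {n : ℕ}
    (hn : 2 ≤ n) (x : ℝ) : gridCount k n (knot k t n) {x} ≤ k := by
  classical
  rw [gridCount_knot k t hn, gridPoints, Multiset.countP_add, Multiset.countP_add,
    Multiset.countP_map]
  rw [countP_replicate_singleton, countP_replicate_singleton]
  change _ + ((Finset.Icc 2 n).filter fun m => t m ∈ ({x} : Set ℝ)).card ≤ k
  by_cases hx : x = 0 ∨ x = 1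
  · have h2 : ((Finset.Icc 2 n).filter fun m => t m ∈ ({x} : Set ℝ)) = ∅ := by
      refine Finset.filter_eq_empty_iff.2 fun m hm hmx => ?_
      have := ht.mem_Ioo m (Finset.mem_Icc.1 hm).1
      rw [Set.mem_singleton_iff.1 hmx] at this
      rcases hx with rfl | rfl
      · exact lt_irrefl _ this.1
      · exact lt_irrefl _ this.2
    rw [h2, Finset.card_empty]
    rcases hx with rfl | rfl <;> simp
  · push Not at hx
    rw [if_neg (Ne.symm hx.1), if_neg (Ne.symm hx.2), zero_add, zero_add]
    have := (Set.encard_le_encard (s := ((Finset.Icc 2 n).filter fun m => t m ∈ ({x} : Set ℝ) :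
      Finset ℕ)) (fun m hm => by
        simp only [Finset.coe_filter, Set.mem_ofPred_eq, Finset.mem_Icc] at hm
        exact ⟨hm.1.1, hm.2⟩)).trans (ht.mult_le x)
    rw [Set.encard_coe_eq_coe_finsetCard] at this
    exact_mod_cast this

theorem le_gridCount_zero (k : ℕ) (t : ℕ → ℝ) {n : ℕ} (hn : 2 ≤ n) :
    k ≤ gridCount k n (knot k t n) {0} := by
  classical
  rw [gridCount_knot k t hn, gridPoints, Multiset.countP_add, Multiset.countP_add,
    countP_replicate_singleton, countP_replicate_singleton]
  simp

theorem le_gridCount_one (k : ℕ) (t : ℕ → ℝ) {n : ℕ} (hn : 2 ≤ n) :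
    k ≤ gridCount k n (knot k t n) {1} := by
  classical
  rw [gridCount_knot k t hn, gridPoints, Multiset.countP_add, Multiset.countP_add,
    countP_replicate_singleton, countP_replicate_singleton]
  simp

theorem IsAdmissible.knot_mem_Icc {k : ℕ} {t : ℕ → ℝ} (ht : IsAdmissible k t) {n j : ℕ}
    (hn : 2 ≤ n) (h1 : 1 ≤ j) (h2 : j ≤ n + 2 * k - 1) : knot k t n j ∈ Set.Icc (0 : ℝ) 1 := by
  have h : knot k t n j ∈ gridPoints k t n := by
    rw [← map_knot k t hn]
    exact Multiset.mem_map_of_mem _ (Finset.mem_Icc.2 ⟨h1, h2⟩)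
  simp only [gridPoints, Multiset.mem_add, Multiset.mem_replicate, Multiset.mem_map,
    Finset.mem_val, Finset.mem_Icc] at h
  rcases h with (⟨-, h⟩ | ⟨-, h⟩) | ⟨m, hm, h⟩
  · simp [h]
  · simp [h]
  · rw [← h]
    exact Set.Ioo_subset_Icc_self (ht.mem_Ioo m hm.1)

theorem volume_real_D {k : ℕ} {t : ℕ → ℝ} {n i l : ℕ} (hn : 2 ≤ n) (hi : 1 ≤ i)
    (hil : i + l ≤ n + 2 * k - 1) :
    volume.real (D k t l n i) = knot k t n (i + l) - knot k t n i :=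
  Real.volume_real_Icc_of_le
    (knot_monotoneOn k t hn ⟨hi, by omega⟩ ⟨by omega, hil⟩ (by omega))

theorem IsRegular.isRegularGrid {k : ℕ} {γ : ℝ} {t : ℕ → ℝ} (hk : 2 ≤ k)
    (h : IsRegular k (k - 1) γ t) : IsRegularGrid k γ (knot k t) where
  mono n hn := knot_monotoneOn k t hn
  count_le n n' hn hnn' A := gridCount_knot_le k t hn hnn' A
  ratio_le n hn i hi hi' := by
    have := (h.2 n hn i (by omega) hi').2
    rwa [volume_real_D hn (by omega) (by omega), volume_real_D hn (by omega) (by omega),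
      show i + 1 + (k - 1) = i + k by omega, ← Nat.add_sub_assoc (by omega)] at this
  ratio_ge n hn i hi hi' := by
    have := (h.2 n hn i (by omega) hi').1
    rwa [div_le_iff₀' (by linarith [h.1]), volume_real_D hn (by omega) (by omega),
      volume_real_D hn (by omega) (by omega),
      show i + 1 + (k - 1) = i + k by omega, ← Nat.add_sub_assoc (by omega)] at this

/-! ### Characteristic intervals -/

/-- What the counting arguments use of a characteristic interval: it is a non-degenerate gap
`[τ q, τ (q + 1)]` of the `n`-th grid. As the new point `t n` and the gap lie in a common support
`[τ j, τ (j + k)]` of which the gap is the longest of `k` pieces, `t n` is close to the gap. As this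
support is almost minimal, all supports `[τ l, τ (l + k)]` around `t n = τ i₀` are at least half as
long as the gap. -/
theorem IsCharInterval.exists_gap {k : ℕ} {t : ℕ → ℝ} (hk : 2 ≤ k) (ht : IsAdmissible k t) {n : ℕ}
    (hn : 2 ≤ n) {I : Set ℝ} (hI : IsCharInterval k t n I) :
    ∃ q, (2 ≤ q ∧ q + 3 ≤ n + 2 * k) ∧ knot k t n q < knot k t n (q + 1) ∧
      I = Set.Icc (knot k t n q) (knot k t n (q + 1)) ∧
      (∀ e ∈ I, |t n - e| ≤ k * (knot k t n (q + 1) - knot k t n q)) ∧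
      ∃ i₀, k + 1 ≤ i₀ ∧ i₀ ≤ n + k - 1 ∧ knot k t n i₀ = t n ∧ ∀ l, i₀ - k ≤ l → l ≤ i₀ →
        (knot k t n (q + 1) - knot k t n q) / 2 ≤ knot k t n (l + k) - knot k t n l := by
  obtain ⟨i₀, hi1, hi2, hi, j, ⟨⟨hj, hjmin⟩, -⟩, r, hr, rfl, hmax⟩ := hI
  rw [Finset.mem_Icc] at hj
  have hmono := knot_monotoneOn k t hn
  have hle : ∀ i i', 1 ≤ i → i ≤ i' → i' ≤ n + 2 * k - 1 → knot k t n i ≤ knot k t n i' :=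
    fun i i' h1 h2 h3 => hmono ⟨h1, by omega⟩ ⟨by omega, h3⟩ h2
  set L := knot k t n (j + r + 1) - knot k t n (j + r) with hL
  have hlen : ∀ s < k, knot k t n (j + s + 1) - knot k t n (j + s) ≤ L := by
    intro s hs
    have := hmax s hs
    rwa [volume_real_D hn (by omega) (by omega), volume_real_D hn (by omega) (by omega)] at this
  have htot : knot k t n (j + k) - knot k t n j ≤ k * L := by
    have h := Finset.sum_range_sub (fun s => knot k t n (j + s)) k
    rw [add_zero] at h
    rw [← h]
    calc _ ≤ ∑ s ∈ Finset.range k, L :=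
          Finset.sum_le_sum fun s hs => hlen s (Finset.mem_range.1 hs)
      _ = k * L := by rw [Finset.sum_const, Finset.card_range, nsmul_eq_mul]
  -- `k + 1` successive knots do not coincide, as no value has multiplicity greater than `k`
  have hpos : 0 < knot k t n (j + k) - knot k t n j := by
    by_contra! hle0
    have hc : (Finset.Icc j (j + k)).card ≤ gridCount k n (knot k t n) {knot k t n j} := by
      classical
      unfold gridCount
      refine Finset.card_le_card fun i hi => ?_
      rw [Finset.mem_Icc] at hi
      rw [Finset.mem_filter, Finset.mem_Icc, Set.mem_singleton_iff]
      refine ⟨⟨by omega, by omega⟩, le_antisymm ?_ (hle j i (by omega) hi.1 (by omega))⟩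
      linarith [hle i (j + k) (by omega) hi.2 (by omega)]
    have := ht.gridCount_singleton_le hn (knot k t n j)
    rw [Nat.card_Icc] at hc
    omega
  have hLpos : 0 < L := by
    by_contra! h
    nlinarith [(Nat.cast_nonneg k : (0 : ℝ) ≤ k)]
  have h1 := hle j (j + r) (by omega) (by omega) (by omega)
  have h2 := hle (j + r + 1) (j + k) (by omega) (by omega) (by omega)
  refine ⟨j + r, ⟨?_, ?_⟩, by linarith, rfl, ?_, i₀, hi1, hi2, hi, ?_⟩
  · -- the first two knots are `0`
    by_contra! hlt
    have hc := le_gridCount_zero k t hn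
    have hsub : gridCount k n (knot k t n) {0} ≤ ({1} : Finset ℕ).card := by
      classical
      unfold gridCount
      refine Finset.card_le_card fun i hi => ?_
      rw [Finset.mem_filter, Finset.mem_Icc, Set.mem_singleton_iff] at hi
      rw [Finset.mem_singleton]
      by_contra hne
      have h3 := hle (j + r + 1) i (by omega) (by omega) (by omega)
      have h4 := (ht.knot_mem_Icc hn (j := j + r) (by omega) (by omega)).1
      linarith
    rw [Finset.card_singleton] at hsub
    omega
  · -- the last two knots are `1`
    by_contra! hlt
    have hc := le_gridCount_one k t hn
    have hsub : gridCount k n (knot k t n) {1} ≤ ({n + 2 * k - 1} : Finset ℕ).card := by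
      classical
      unfold gridCount
      refine Finset.card_le_card fun i hi => ?_
      rw [Finset.mem_filter, Finset.mem_Icc, Set.mem_singleton_iff] at hi
      rw [Finset.mem_singleton]
      by_contra hne
      have h3 := hle i (j + r) (by omega) (by omega) (by omega)
      have h4 := (ht.knot_mem_Icc hn (j := j + r + 1) (by omega) (by omega)).2
      linarith
    rw [Finset.card_singleton] at hsub
    omega
  · intro e he
    have h3 := hle j i₀ (by omega) (by omega) (by omega)
    have h4 := hle i₀ (j + k) (by omega) (by omega) (by omega)
    rw [hi] at h3 h4
    rw [abs_le]
    constructor <;> linarith [he.1, he.2]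
  · intro l hl1 hl2
    have h3 := hjmin l (Finset.mem_Icc.2 ⟨hl1, hl2⟩)
    rw [volume_real_D hn (by omega) (by omega), volume_real_D hn (by omega) (by omega)] at h3
    linarith

/-- If all supports around the new point are longer than `δ` for each `n ∈ S`, then an interval of
length less than `δ` contains at most `k` of the points `t n`, `n ∈ S`: otherwise, it would contain
such a support for the last of these `n`. -/
theorem card_le_of_support_gt {k : ℕ} {t : ℕ → ℝ} {δ : ℝ} {A : Set ℝ} (hA : A.OrdConnected)
    (hdiam : ∀ x ∈ A, ∀ y ∈ A, y - x < δ) (S : Finset ℕ) (hS : ∀ n ∈ S, 2 ≤ n ∧ t n ∈ A)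
    (hwin : ∀ n ∈ S, ∃ i₀, k + 1 ≤ i₀ ∧ i₀ ≤ n + k - 1 ∧ knot k t n i₀ = t n ∧
      ∀ l, i₀ - k ≤ l → l ≤ i₀ → δ ≤ knot k t n (l + k) - knot k t n l) : S.card ≤ k := by
  classical
  by_contra! hlt
  have hne : S.Nonempty := Finset.card_pos.1 (by omega)
  set n := S.max' hne with hndef
  have hnS : n ∈ S := S.max'_mem hne
  obtain ⟨hn, htA⟩ := hS n hnS
  obtain ⟨i₀, hi1, hi2, hi, hδ⟩ := hwin n hnS
  have hc := card_filter_le_gridCount_knot k t hn A S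
    fun m hm => ⟨(hS m hm).1, S.le_max' m hm, (hS m hm).2⟩
  unfold gridCount at hc
  set T := (Finset.Icc 1 (n + 2 * k - 1)).filter fun j => knot k t n j ∈ A with hT
  have hi₀T : i₀ ∈ T := by
    rw [hT, Finset.mem_filter, Finset.mem_Icc, hi]
    exact ⟨⟨by omega, by omega⟩, htA⟩
  have hTne : T.Nonempty := ⟨i₀, hi₀T⟩
  have hp := T.min'_mem hTne
  have hq := T.max'_mem hTne
  have hpi := T.min'_le i₀ hi₀T
  have hqi := T.le_max' i₀ hi₀T
  set p := T.min' hTne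
  set q := T.max' hTne
  have hsub : T ⊆ Finset.Icc p q :=
    fun j hj => Finset.mem_Icc.2 ⟨T.min'_le j hj, T.le_max' j hj⟩
  have hcard := Finset.card_le_card hsub
  rw [Nat.card_Icc] at hcard
  rw [hT, Finset.mem_filter, Finset.mem_Icc] at hp hq
  have hmem : ∀ j, p ≤ j → j ≤ q → knot k t n j ∈ A := fun j h1 h2 =>
    hA.out hp.2 hq.2 ⟨knot_monotoneOn k t hn ⟨hp.1.1, hp.1.2⟩ ⟨by omega, by omega⟩ h1,
      knot_monotoneOn k t hn ⟨by omega, by omega⟩ ⟨hq.1.1, hq.1.2⟩ h2⟩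
  have h1 := hδ (max p (i₀ - k)) (by omega) (by omega)
  have h2 := hdiam _ (hmem (max p (i₀ - k)) (by omega) (by omega)) _
    (hmem (max p (i₀ - k) + k) (by omega) (by omega))
  linarith

/-- Only boundedly many characteristic intervals of comparable length contain a given point. -/
theorem card_charInterval_le {k : ℕ} {t : ℕ → ℝ} (hk : 2 ≤ k) (ht : IsAdmissible k t)
    {J : ℕ → Set ℝ} (hJ : ∀ n, 2 ≤ n → IsCharInterval k t n (J n)) (S : Finset ℕ) {e y : ℝ}
    (hy : 0 < y)
    (hS : ∀ n ∈ S, 2 ≤ n ∧ e ∈ J n ∧ y / 2 < volume.real (J n) ∧ volume.real (J n) ≤ y) :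
    S.card ≤ k * (8 * k + 1) := by
  -- the points `t n` lie within `k y` of `e`: split this range into cells of length `y / 4`
  have hgap : ∀ n ∈ S, |t n - e| ≤ k * y ∧ ∃ i₀, k + 1 ≤ i₀ ∧ i₀ ≤ n + k - 1 ∧
      knot k t n i₀ = t n ∧ ∀ l, i₀ - k ≤ l → l ≤ i₀ →
        y / 4 ≤ knot k t n (l + k) - knot k t n l := by
    intro n hnS
    obtain ⟨hn, he, h1, h2⟩ := hS n hnS
    obtain ⟨q, -, hqq, hI, hdist, i₀, hi1, hi2, hi, hwin⟩ := (hJ n hn).exists_gap hk ht hn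
    rw [hI, Real.volume_real_Icc_of_le hqq.le] at h1 h2
    refine ⟨(hdist e he).trans (by gcongr), i₀, hi1, hi2, hi, fun l hl1 hl2 => ?_⟩
    linarith [hwin l hl1 hl2]
  have hy4 : 0 < y / 4 := by positivity
  let f : ℕ → ℕ := fun n => ⌊(t n - (e - k * y)) / (y / 4)⌋₊
  have hf : ∀ n ∈ S, f n ∈ Finset.range (8 * k + 1) := by
    intro n hnS
    have h := abs_le.1 (hgap n hnS).1
    rw [Finset.mem_range, Nat.lt_succ_iff]
    refine Nat.floor_le_of_le ?_
    rw [div_le_iff₀ hy4]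
    push_cast
    linarith
  have hcell : ∀ c ∈ Finset.range (8 * k + 1), (S.filter fun n => f n = c).card ≤ k := by
    intro c _
    refine card_le_of_support_gt (t := t) (δ := y / 4)
      (A := Set.Ico (e - k * y + c * (y / 4)) (e - k * y + (c + 1) * (y / 4)))
      Set.ordConnected_Ico ?_ _ ?_ ?_
    · intro x hx x' hx'
      linarith [hx.1, hx'.2]
    · intro n hn
      rw [Finset.mem_filter] at hn
      have h := abs_le.1 (hgap n hn.1).1
      have hfl := (Nat.floor_eq_iff (div_nonneg (by linarith) hy4.le)).1 hn.2
      rw [le_div_iff₀ hy4, div_lt_iff₀ hy4] at hfl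
      exact ⟨(hS n hn.1).1, by linarith, by linarith⟩
    · intro n hn
      exact (hgap n (Finset.mem_filter.1 hn).1).2
  have := Finset.card_le_mul_card_image_of_maps_to hf k hcell
  rwa [Finset.card_range] at this

/-! ### Summation over the two index sets -/

theorem summable_and_tsum_le_of_sum_le {s : Set ℕ} {f : ℕ → ℝ} {C : ℝ}
    (hf : ∀ n ∈ s, 0 ≤ f n) (h : ∀ P : Finset ℕ, (∀ n ∈ P, n ∈ s) → ∑ n ∈ P, f n ≤ C) :
    Summable (fun n : s => f n) ∧ ∑' n : s, f n ≤ C := by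
  have hfin : ∀ u : Finset s, ∑ n ∈ u, f n ≤ C := by
    intro u
    have := h (u.map (Function.Embedding.subtype _)) fun n hn => by
      obtain ⟨m, -, rfl⟩ := Finset.mem_map.1 hn
      exact m.2
    rwa [Finset.sum_map] at this
  have hs : Summable (fun n : s => f n) := summable_of_sum_le (fun n => hf n n.2) hfin
  exact ⟨hs, hs.tsum_le_of_sum_le hfin⟩

theorem le_setDist {A B : Set ℝ} (hA : A.Nonempty) (hB : B.Nonempty) {r : ℝ}
    (h : ∀ x ∈ A, ∀ y ∈ B, r ≤ |x - y|) : r ≤ setDist A B := by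
  obtain ⟨x, hx⟩ := hA
  obtain ⟨y, hy⟩ := hB
  refine le_csInf ⟨_, x, hx, y, hy, rfl⟩ ?_
  rintro _ ⟨x, hx, y, hy, rfl⟩
  exact h x hx y hy

theorem setDist_nonneg (A B : Set ℝ) : 0 ≤ setDist A B := by
  refine Real.sInf_nonneg ?_
  rintro _ ⟨x, -, y, -, rfl⟩
  exact abs_nonneg _

theorem gridDist_eq_of_le {k n : ℕ} {t : ℕ → ℝ} {a b c d : ℝ} (hab : a ≤ b) (hbc : b ≤ c)
    (hcd : c < d) :
    gridDist k t n (Set.Icc c d) (Set.Icc a b) = gridCount k n (knot k t n) (Set.Icc b c) := by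
  classical
  unfold gridDist gridCount
  congr 1
  ext j
  simp only [Finset.mem_filter]
  refine and_congr_right fun _ => ?_
  constructor
  · rintro (h | h)
    · exact h b ⟨hab, le_rfl⟩ c ⟨le_rfl, hcd.le⟩
    · have := h a ⟨le_rfl, hab⟩ d ⟨hcd.le, le_rfl⟩
      linarith
  · exact fun h => Or.inl fun v hv x hx => ⟨hv.2.trans h.1, h.2.trans hx.1⟩

theorem gridDist_eq_of_ge {k n : ℕ} {t : ℕ → ℝ} {a b c d : ℝ} (hab : a ≤ b) (hda : d ≤ a)
    (hcd : c < d) :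
    gridDist k t n (Set.Icc c d) (Set.Icc a b) = gridCount k n (knot k t n) (Set.Icc d a) := by
  classical
  unfold gridDist gridCount
  congr 1
  ext j
  simp only [Finset.mem_filter]
  refine and_congr_right fun _ => ?_
  constructor
  · rintro (h | h)
    · have := h b ⟨hab, le_rfl⟩ c ⟨le_rfl, hcd.le⟩
      linarith
    · exact h a ⟨le_rfl, hab⟩ d ⟨hcd.le, le_rfl⟩
  · exact fun h => Or.inr fun v hv x hx => ⟨hx.2.trans h.1, h.2.trans hv.1⟩

/-- An interval that contains a grid point and meets a gap of the grid in a null set lies on one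
side of the gap. -/
theorem le_or_le_of_volume_inter {k n q : ℕ} {σ : ℕ → ℝ}
    (hσ : MonotoneOn σ (Set.Icc 1 (n + 2 * k - 1))) (hq1 : 1 ≤ q) (hq2 : q + 1 ≤ n + 2 * k - 1)
    (hqq : σ q < σ (q + 1)) {a b : ℝ} {j : ℕ} (hj1 : 1 ≤ j) (hj2 : j ≤ n + 2 * k - 1)
    (hj : σ j ∈ Set.Icc a b) (hvol : volume (Set.Icc (σ q) (σ (q + 1)) ∩ Set.Icc a b) = 0) :
    b ≤ σ q ∨ σ (q + 1) ≤ a := by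
  by_contra! h
  rw [Set.Icc_inter_Icc, Real.volume_Icc, ENNReal.ofReal_eq_zero, sub_nonpos] at hvol
  -- the intersection can only be null if `a = b`, which is then a grid point inside the gap
  have hba : b ≤ a := by
    rcases le_total (σ (q + 1)) b with h1 | h1 <;> rcases le_total (σ q) a with h2 | h2 <;>
      simp only [h1, h2, sup_of_le_left, sup_of_le_right, inf_of_le_left, inf_of_le_right]
        at hvol <;> linarith [h.1, h.2]
  rcases Nat.lt_or_ge q j with hlt | hge
  · linarith [hσ (a := q + 1) (b := j) ⟨by omega, hq2⟩ ⟨hj1, hj2⟩ hlt, hj.2, h.2]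
  · linarith [hσ (a := j) (b := q) ⟨hj1, hj2⟩ ⟨hq1, by omega⟩ hge, hj.1, h.1]

/-- The first sum of the theorem, over finitely many `n`: at most `k + 2` left end points occur, and
the gaps with a given left end point contribute a multiple of the length of the interval. -/
theorem sum_indexN_le {k : ℕ} (hk : 2 ≤ k) {t : ℕ → ℝ} (ht : IsAdmissible k t)
    {J : ℕ → Set ℝ} (hJ : ∀ n, 2 ≤ n → IsCharInterval k t n (J n)) (a b : ℝ) (P : Finset ℕ)
    (hP : ∀ n ∈ P, n ∈ indexN k t J (Set.Icc a b)) :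
    ∑ n ∈ P, volume.real (J n) ≤
      (k + 2) * (2 * ((k * (8 * k + 1) : ℕ) : ℝ)) * volume.real (Set.Icc a b) := by
  classical
  rcases P.eq_empty_or_nonempty with rfl | hne
  · rw [Finset.sum_empty]
    positivity
  have hgap : ∀ n, 2 ≤ n → ∃ q, (2 ≤ q ∧ q + 3 ≤ n + 2 * k) ∧
      knot k t n q < knot k t n (q + 1) ∧
      J n = Set.Icc (knot k t n q) (knot k t n (q + 1)) := fun n hn => by
    obtain ⟨q, h1, h2, h3, -⟩ := (hJ n hn).exists_gap hk ht hn
    exact ⟨q, h1, h2, h3⟩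
  choose! q hq hqq hJq using hgap
  have hc : ∀ n ∈ P, knot k t n (q n) ∈ J n := fun n hn => by
    rw [hJq n (hP n hn).1]
    exact ⟨le_rfl, (hqq n (hP n hn).1).le⟩
  -- all left end points are knots of the last grid in `[a, b]`, of which there are at most `k + 2`
  set N := P.max' hne
  have hN := hP N (P.max'_mem hne)
  set T := (Finset.Icc 1 (N + 2 * k - 1)).filter fun j => knot k t N j ∈ Set.Icc a b with hT
  have hTcard : T.card ≤ k + 2 := by
    have h1 : T ⊆ insert 1 (insert (N + 2 * k - 1)
        ((Finset.Icc 2 (N + 2 * k - 2)).filter fun j => knot k t N j ∈ Set.Icc a b)) := by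
      intro j hj
      simp only [hT, Finset.mem_filter, Finset.mem_Icc, Finset.mem_insert] at hj ⊢
      by_cases h1 : j = 1
      · exact Or.inl h1
      by_cases h2 : j = N + 2 * k - 1
      · exact Or.inr (Or.inl h2)
      · exact Or.inr (Or.inr ⟨⟨by omega, by omega⟩, hj.2⟩)
    have h2 : ((Finset.Icc 2 (N + 2 * k - 2)).filter
        fun j => knot k t N j ∈ Set.Icc a b).card = k := by
      refine Eq.trans ?_ hN.2.1
      unfold cardKnots
      congr
    have h3 := Finset.card_le_card h1
    have h4 := Finset.card_insert_le 1 (insert (N + 2 * k - 1)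
        ((Finset.Icc 2 (N + 2 * k - 2)).filter fun j => knot k t N j ∈ Set.Icc a b))
    have h5 := Finset.card_insert_le (N + 2 * k - 1)
        ((Finset.Icc 2 (N + 2 * k - 2)).filter fun j => knot k t N j ∈ Set.Icc a b)
    omega
  have hmaps : ∀ n ∈ P, knot k t n (q n) ∈ T.image (knot k t N) := by
    intro n hn
    have hn2 := (hP n hn).1
    have hqn := hq n hn2
    obtain ⟨j, hj1, hj2, hj⟩ := exists_eq_of_gridCount_le
      (gridCount_knot_le k t hn2 (P.le_max' n hn)) (j := q n) (by omega) (by omega)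
    refine Finset.mem_image.2 ⟨j, ?_, hj⟩
    simp only [hT, Finset.mem_filter, Finset.mem_Icc]
    refine ⟨⟨hj1, hj2⟩, ?_⟩
    rw [hj]
    exact (hP n hn).2.2 (hc n hn)
  have hfiber : ∀ e ∈ T.image (knot k t N), ∑ n ∈ P with knot k t n (q n) = e,
      volume.real (J n) ≤ 2 * ((k * (8 * k + 1) : ℕ) : ℝ) * volume.real (Set.Icc a b) := by
    intro e _
    refine sum_le_of_dyadic_card_le _ ?_ ?_ measureReal_nonneg ?_
    · intro n hn
      have hn2 := (hP n (Finset.mem_filter.1 hn).1).1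
      rw [hJq n hn2, Real.volume_real_Icc_of_le (hqq n hn2).le]
      linarith [hqq n hn2]
    · intro y hy
      rw [Nat.cast_le]
      refine card_charInterval_le hk ht hJ _ (e := e) hy fun n hn => ?_
      simp only [Finset.mem_filter] at hn
      refine ⟨(hP n hn.1.1).1, ?_, hn.2⟩
      rw [← hn.1.2]
      exact hc n hn.1.1
    · intro n hn
      exact measureReal_mono (hP n (Finset.mem_filter.1 hn).1).2.2 isCompact_Icc.measure_lt_top.ne
  calc ∑ n ∈ P, volume.real (J n)
      = ∑ e ∈ T.image (knot k t N), ∑ n ∈ P with knot k t n (q n) = e, volume.real (J n) :=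
        (Finset.sum_fiberwise_of_maps_to hmaps _).symm
    _ ≤ (T.image (knot k t N)).card •
        (2 * ((k * (8 * k + 1) : ℕ) : ℝ) * volume.real (Set.Icc a b)) :=
        Finset.sum_le_card_nsmul _ _ _ hfiber
    _ ≤ _ := by
        rw [nsmul_eq_mul, mul_assoc ((k : ℝ) + 2)]
        have : ((T.image (knot k t N)).card : ℝ) ≤ k + 2 := by
          exact_mod_cast Finset.card_image_le.trans hTcard
        gcongr

/-- The second sum of the theorem, over finitely many `n`: the gaps to the right and to the left of
the interval are treated separately. -/
theorem sum_indexM_le {k : ℕ} (hk : 2 ≤ k) {γ : ℝ} {t : ℕ → ℝ} (ht : IsAdmissible k t)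
    (hγ : IsRegular k (k - 1) γ t) {J : ℕ → Set ℝ}
    (hJ : ∀ n, 2 ≤ n → IsCharInterval k t n (J n)) {a b : ℝ} (hab : a ≤ b) (l : ℕ)
    (P : Finset ℕ) (hP : ∀ n ∈ P, n ∈ indexM k t J (Set.Icc a b) l) :
    ∑ n ∈ P, volume.real (J n) / (setDist (J n) (Set.Icc a b) + volume.real (Set.Icc a b)) ≤
      2 * (2 * ((k * (8 * k + 1) : ℕ) : ℝ) * ((1 + γ) * ((l + 1) * γ))) := by
  classical
  have hgap : ∀ n, 2 ≤ n → ∃ q, (2 ≤ q ∧ q + 3 ≤ n + 2 * k) ∧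
      knot k t n q < knot k t n (q + 1) ∧
      J n = Set.Icc (knot k t n q) (knot k t n (q + 1)) := fun n hn => by
    obtain ⟨q, h1, h2, h3, -⟩ := (hJ n hn).exists_gap hk ht hn
    exact ⟨q, h1, h2, h3⟩
  choose! q hq hqq hJq using hgap
  have hgrid := hγ.isRegularGrid hk
  have hcard : ∀ n ∈ P, k ≤ ((Finset.Icc 2 (n + 2 * k - 2)).filter
      fun j => knot k t n j ∈ Set.Icc a b).card := by
    intro n hn
    refine (hP n hn).2.2.1.trans (le_of_eq ?_)
    unfold cardKnots
    congr
  have hside : ∀ n ∈ P, ¬ b ≤ knot k t n (q n) → knot k t n (q n + 1) ≤ a := by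
    intro n hn hb
    have hn2 := (hP n hn).1
    have hqn := hq n hn2
    obtain ⟨j, hj⟩ := Finset.card_pos.1 (lt_of_lt_of_le (by omega) (hcard n hn))
    rw [Finset.mem_filter, Finset.mem_Icc] at hj
    have hvol := (hP n hn).2.2.2
    rw [hJq n hn2] at hvol
    exact (le_or_le_of_volume_inter (knot_monotoneOn k t hn2) (by omega) (by omega) (hqq n hn2)
      (by omega) (by omega) hj.2 hvol).resolve_left hb
  have hvolJ : ∀ n ∈ P, volume.real (J n) = knot k t n (q n + 1) - knot k t n (q n) :=
    fun n hn => by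
      rw [hJq n (hP n hn).1, Real.volume_real_Icc_of_le (hqq n (hP n hn).1).le]
  have hcount : ∀ (Q : Finset ℕ) (e y : ℝ), Q ⊆ P → 0 < y → (∀ n ∈ Q, e ∈ J n ∧
      y / 2 < knot k t n (q n + 1) - knot k t n (q n) ∧
      knot k t n (q n + 1) - knot k t n (q n) ≤ y) →
      (Q.card : ℝ) ≤ ((k * (8 * k + 1) : ℕ) : ℝ) := by
    intro Q e y hQP hy hQ
    rw [Nat.cast_le]
    refine card_charInterval_le hk ht hJ Q (e := e) hy fun n hn => ?_
    rw [hvolJ n (hQP hn)]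
    exact ⟨(hP n (hQP hn)).1, hQ n hn⟩
  have hright := hgrid.sum_right_le hk hγ.1 hab (q := q) (ℓ := l)
    (F := ((k * (8 * k + 1) : ℕ) : ℝ))
    (w := fun n => setDist (J n) (Set.Icc a b) + volume.real (Set.Icc a b))
    (P.filter fun n => b ≤ knot k t n (q n))
    (fun n hn => (hP n (Finset.mem_filter.1 hn).1).1)
    (fun n hn => (hq n (hP n (Finset.mem_filter.1 hn).1).1).1)
    (fun n hn => (hq n (hP n (Finset.mem_filter.1 hn).1).1).2)
    (fun n hn => hqq n (hP n (Finset.mem_filter.1 hn).1).1)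
    (fun n hn => (Finset.mem_filter.1 hn).2)
    (fun n hn => hcard n (Finset.mem_filter.1 hn).1)
    (fun n hn => by
      rw [Finset.mem_filter] at hn
      have h := (hP n hn.1).2.1
      rwa [hJq n (hP n hn.1).1, gridDist_eq_of_le hab hn.2 (hqq n (hP n hn.1).1)] at h)
    (fun e y hy => hcount _ e y
      ((Finset.filter_subset _ _).trans (Finset.filter_subset _ _)) hy fun n hn => by
        simp only [Finset.mem_filter] at hn
        have hn2 := (hP n hn.1.1).1
        refine ⟨?_, hn.2.2⟩
        rw [hJq n hn2, ← hn.2.1]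
        exact ⟨le_rfl, (hqq n hn2).le⟩)
    (fun n hn => by
      rw [Finset.mem_filter] at hn
      have hn2 := (hP n hn.1).1
      have h : knot k t n (q n) - b ≤ setDist (J n) (Set.Icc a b) := by
        rw [hJq n hn2]
        refine le_setDist (Set.nonempty_Icc.2 (hqq n hn2).le) (Set.nonempty_Icc.2 hab) ?_
        intro x hx y hy
        exact le_trans (by linarith [hx.1, hy.2]) (le_abs_self _)
      rw [Real.volume_real_Icc_of_le hab]
      linarith)
  have hleft := hgrid.sum_left_le hk hγ.1 hab (q := q) (ℓ := l)
    (F := ((k * (8 * k + 1) : ℕ) : ℝ))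
    (w := fun n => setDist (J n) (Set.Icc a b) + volume.real (Set.Icc a b))
    (P.filter fun n => ¬ b ≤ knot k t n (q n))
    (fun n hn => (hP n (Finset.mem_filter.1 hn).1).1)
    (fun n hn => (hq n (hP n (Finset.mem_filter.1 hn).1).1).1)
    (fun n hn => (hq n (hP n (Finset.mem_filter.1 hn).1).1).2)
    (fun n hn => hqq n (hP n (Finset.mem_filter.1 hn).1).1)
    (fun n hn => hside n (Finset.mem_filter.1 hn).1 (Finset.mem_filter.1 hn).2)
    (fun n hn => hcard n (Finset.mem_filter.1 hn).1)
    (fun n hn => by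
      rw [Finset.mem_filter] at hn
      have h := (hP n hn.1).2.1
      rwa [hJq n (hP n hn.1).1,
        gridDist_eq_of_ge hab (hside n hn.1 hn.2) (hqq n (hP n hn.1).1)] at h)
    (fun e y hy => hcount _ e y
      ((Finset.filter_subset _ _).trans (Finset.filter_subset _ _)) hy fun n hn => by
        simp only [Finset.mem_filter] at hn
        have hn2 := (hP n hn.1.1).1
        refine ⟨?_, hn.2.2⟩
        rw [hJq n hn2, ← hn.2.1]
        exact ⟨(hqq n hn2).le, le_rfl⟩)
    (fun n hn => by
      rw [Finset.mem_filter] at hn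
      have hn2 := (hP n hn.1).1
      have h : a - knot k t n (q n + 1) ≤ setDist (J n) (Set.Icc a b) := by
        rw [hJq n hn2]
        refine le_setDist (Set.nonempty_Icc.2 (hqq n hn2).le) (Set.nonempty_Icc.2 hab) ?_
        intro x hx y hy
        exact le_trans (by linarith [hx.2, hy.1]) (neg_le_abs _)
      rw [Real.volume_real_Icc_of_le hab]
      linarith)
  rw [Finset.sum_congr rfl fun n hn => by rw [hvolJ n hn],
    ← Finset.sum_filter_add_sum_filter_not P (fun n => b ≤ knot k t n (q n))]
  linarith

end SplineKnots

theorem lemma3p7 (k : ℕ) (hk : 2 ≤ k) :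
    (∃ C : ℝ, 0 < C ∧ ∀ t : ℕ → ℝ, SplineKnots.IsAdmissible k t →
      (∃ γ : ℝ, SplineKnots.IsRegular k (k - 1) γ t) →
      ∀ J : ℕ → Set ℝ, (∀ n, 2 ≤ n → SplineKnots.IsCharInterval k t n (J n)) →
      ∀ m i : ℕ, 2 ≤ m → 2 ≤ i → i ≤ m + k - 1 →
        Summable (fun n : SplineKnots.indexN k t J (SplineKnots.D k t (k - 1) m i) =>
          volume.real (J n)) ∧
        ∑' n : SplineKnots.indexN k t J (SplineKnots.D k t (k - 1) m i), volume.real (J n) ≤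
          C * volume.real (SplineKnots.D k t (k - 1) m i)) ∧
    (∀ γ : ℝ, 1 ≤ γ → ∃ C : ℝ, 0 < C ∧ ∀ t : ℕ → ℝ, SplineKnots.IsAdmissible k t →
      SplineKnots.IsRegular k (k - 1) γ t →
      ∀ J : ℕ → Set ℝ, (∀ n, 2 ≤ n → SplineKnots.IsCharInterval k t n (J n)) →
      ∀ m i : ℕ, 2 ≤ m → 2 ≤ i → i ≤ m + k - 1 → ∀ l : ℕ,
        Summable (fun n : SplineKnots.indexM k t J (SplineKnots.D k t (k - 1) m i) l =>
          volume.real (J n) / (SplineKnots.setDist (J n) (SplineKnots.D k t (k - 1) m i) +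
            volume.real (SplineKnots.D k t (k - 1) m i))) ∧
        ∑' n : SplineKnots.indexM k t J (SplineKnots.D k t (k - 1) m i) l,
          volume.real (J n) / (SplineKnots.setDist (J n) (SplineKnots.D k t (k - 1) m i) +
            volume.real (SplineKnots.D k t (k - 1) m i)) ≤
          C * ((l : ℝ) + 1) ^ 2) := by
  refine ⟨⟨(k + 2) * (2 * ((k * (8 * k + 1) : ℕ) : ℝ)), ?_, ?_⟩, fun γ hγ =>
    ⟨2 * (2 * ((k * (8 * k + 1) : ℕ) : ℝ) * ((1 + γ) * γ)), ?_, ?_⟩⟩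
  · have : 0 < k := by omega
    positivity
  · intro t ht _ J hJ m i _ _ _
    exact SplineKnots.summable_and_tsum_le_of_sum_le (fun n _ => MeasureTheory.measureReal_nonneg)
      fun P hP => SplineKnots.sum_indexN_le hk ht hJ _ _ P hP
  · have : 0 < k := by omega
    have : 0 < γ := by linarith
    positivity
  · intro t ht hreg J hJ m i hm hi hi' l
    refine SplineKnots.summable_and_tsum_le_of_sum_le (fun n _ => div_nonneg
      MeasureTheory.measureReal_nonneg (add_nonneg (SplineKnots.setDist_nonneg _ _)
        MeasureTheory.measureReal_nonneg)) fun P hP => ?_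
    refine (SplineKnots.sum_indexM_le hk ht hreg hJ (SplineKnots.knot_monotoneOn k t hm
      ⟨by omega, by omega⟩ ⟨by omega, by omega⟩ (by omega)) l P hP).trans ?_
    have h1 : (l : ℝ) + 1 ≤ ((l : ℝ) + 1) ^ 2 := by
      nlinarith [(Nat.cast_nonneg l : (0 : ℝ) ≤ l)]
    calc _ = 2 * (2 * ((k * (8 * k + 1) : ℕ) : ℝ) * ((1 + γ) * γ)) * ((l : ℝ) + 1) := by ring
      _ ≤ _ := by gcongr
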